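/- Let $n_+,n_-\geq 1$ be integers and $n:=n_++n_-$. Let $\lambda_1,\dots,\lambda_{n_+}\colon[0,\infty)\to(0,\infty)$ and $\theta_1,\dots,\theta_{n_-}\colon[0,\infty)\to(-\infty,0)$ be continuous functions such that $\frac{1}{\lambda_k}\notin L^1(0,\infty)$ and $\frac{1}{\theta_j}\notin L^1(0,\infty)$ for all $k=1,\dots,n_+$ and $j=1,\dots,n_-$. Put $\Lambda=\operatorname{diag}(\lambda_1,\dots,\lambda_{n_+})$, $\Theta=\operatorname{diag}(\theta_1,\dots,\theta_{n_-})$, $\Delta=\operatorname{diag}(\Lambda,\Theta)\colon[0,\infty)\to\mathbb{R}^{n\times n}$ and $|\Delta|=\operatorname{diag}(\lambda_1,\dots,\lambda_{n_+},|\theta_1|,\dots,|\theta_{n_-}|)$. Let $$L^2_{|\Delta|}(0,\infty)=\Bigl\{x\colon[0,\infty)\to\mathbb{C}^n \;;\; x\text{ measurable and } \|x\|^2:=\int_0^\infty x(\xi)^{\star}|\Delta(\xi)|x(\xi)\,\mathrm{d}\xi<\infty\Bigr\},$$ where functions that agree almost everywhere are identified. Then the operator $A_\Delta\colon D(A_\Delta)\to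 L^2_{|\Delta|}(0,\infty)$ given by $$A_\Delta x=(\Delta x)',$$ $$D(A_\Delta)=\bigl\{x\in L^2_{|\Delta|}(0,\infty)\;;\;\Delta x\in \mathrm{AC}_{\mathrm{loc}}[0,\infty),\ (\Delta x)'\in L^2_{|\Delta|}(0,\infty)\text{ and }(\Theta x)(0)=0\bigr\}$$ generates a $C_0$-semigroup on $L^2_{|\Delta|}(0,\infty)$. Here $\Delta x\in\mathrm{AC}_{\mathrm{loc}}[0,\infty)$ means that $\Delta x$ has a (necessarily unique) representative that is absolutely continuous on every compact interval $[a,b]\subseteq[0,\infty)$; $(\Delta x)'$ is its derivative, which exists almost everywhere, and $(\Theta x)(0)$ denotes the last $n_-$ components of the value of this representative at $0$. -/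

import Mathlib

open Set Filter Topology MeasureTheory
open scoped NNReal ENNReal Matrix

noncomputable section

namespace DiagTransport

/-! ## Strongly continuous semigroups and generators -/

/-- A `C₀`-semigroup of bounded linear operators on a complex normed space: `T 0 = id`,
`T (s + t) = T s ∘ T t`, and all orbits `t ↦ T t x`, `t ≥ 0`, are norm continuous. -/
structure C0Semigroup (X : Type*) [NormedAddCommGroup X] [NormedSpace ℂ X] where
  T : ℝ≥0 → X →L[ℂ] X
  map_zero : T 0 = ContinuousLinearMap.id ℂ X
  map_add : ∀ s t : ℝ≥0, T (s + t) = (T s).comp (T t)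
  continuous_orbit : ∀ x : X, Continuous fun t : ℝ≥0 => T t x

/-- The (unbounded) operator `A` is the infinitesimal generator of the semigroup `S`: `x` lies in
the domain of `A` with `A x = y` if and only if `(T t x - x) / t → y` in norm as `t ↘ 0`.
In particular the domain of `A` is exactly the set of those `x` for which the limit exists. -/
def C0Semigroup.IsGenerator {X : Type*} [NormedAddCommGroup X] [NormedSpace ℂ X]
    (S : C0Semigroup X) (A : X →ₗ.[ℂ] X) : Prop :=
  ∀ x y : X, (∃ hx : x ∈ A.domain, A ⟨x, hx⟩ = y) ↔
    Tendsto (fun t : ℝ≥0 => (((t : ℝ) : ℂ)⁻¹) • (S.T t x - x)) (𝓝[>] 0) (𝓝 y)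

/-- The operator `A` generates a `C₀`-semigroup. -/
def GeneratesC0Semigroup {X : Type*} [NormedAddCommGroup X] [NormedSpace ℂ X]
    (A : X →ₗ.[ℂ] X) : Prop :=
  ∃ S : C0Semigroup X, S.IsGenerator A

/-! ## The diagonal matrix functions -/

/-- The diagonal entries `λ_k : [0,∞) → (0,∞)` and `θ_j : [0,∞) → (-∞,0)`, continuous. A function
on `[0,∞)` is a function on `ℝ` of which only the values on `[0,∞)` are used. -/
structure DiagCoeff (p q : ℕ) where
  lam : Fin p → ℝ → ℝ
  theta : Fin q → ℝ → ℝ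
  lam_cont : ∀ k, ContinuousOn (lam k) (Ici 0)
  theta_cont : ∀ j, ContinuousOn (theta j) (Ici 0)
  lam_pos : ∀ k, ∀ ξ ∈ Ici (0 : ℝ), 0 < lam k ξ
  theta_neg : ∀ j, ∀ ξ ∈ Ici (0 : ℝ), theta j ξ < 0

/-- The index set of the `n = p + q` coordinates: first the positive, then the negative ones. -/
abbrev Idx (p q : ℕ) : Type := Fin p ⊕ Fin q

/-- A real matrix acting on a complex vector. -/
def act {ι : Type*} [Fintype ι] (M : Matrix ι ι ℝ) (v : ι → ℂ) : ι → ℂ :=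
  M.map Complex.ofReal *ᵥ v

/-- Lebesgue measure on `(0,∞)`. -/
abbrev vol0 : Measure ℝ := volume.restrict (Ioi 0)

namespace DiagCoeff

variable {p q : ℕ} (D : DiagCoeff p q)

/-- `Λ = diag(λ_1, …, λ_p)`. -/
def Lam (ξ : ℝ) : Matrix (Fin p) (Fin p) ℝ := Matrix.diagonal fun k => D.lam k ξ

/-- `Θ = diag(θ_1, …, θ_q)`. -/
def Theta (ξ : ℝ) : Matrix (Fin q) (Fin q) ℝ := Matrix.diagonal fun j => D.theta j ξ

/-- `Δ = diag(Λ, Θ)`. -/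
def Delta (ξ : ℝ) : Matrix (Idx p q) (Idx p q) ℝ :=
  Matrix.fromBlocks (D.Lam ξ) 0 0 (D.Theta ξ)

/-- `|Δ| = diag(λ_1, …, λ_p, |θ_1|, …, |θ_q|)`. -/
def absDelta (ξ : ℝ) : Matrix (Idx p q) (Idx p q) ℝ :=
  Matrix.diagonal (Sum.elim (fun k => D.lam k ξ) (fun j => |D.theta j ξ|))

/-- The density `x^* |Δ| y` at the point `ξ`. -/
def form (ξ : ℝ) (x y : Idx p q → ℂ) : ℂ := star x ⬝ᵥ act (D.absDelta ξ) y

/-- The diagonal entries of `|Δ|`. -/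
def wt (i : Idx p q) (ξ : ℝ) : ℝ :=
  Sum.elim (fun k => D.lam k ξ) (fun j => |D.theta j ξ|) i

/-- The square roots of the diagonal entries of `|Δ|`. -/
def rt (i : Idx p q) (ξ : ℝ) : ℂ := ((Real.sqrt (D.wt i ξ) : ℝ) : ℂ)

theorem wt_cont (i : Idx p q) : ContinuousOn (D.wt i) (Ici 0) := by
  rcases i with k | j
  · exact D.lam_cont k
  · exact (D.theta_cont j).abs

theorem wt_pos (i : Idx p q) {ξ : ℝ} (hξ : 0 ≤ ξ) : 0 < D.wt i ξ := by
  rcases i with k | j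
  · exact D.lam_pos k ξ hξ
  · exact abs_pos.2 (D.theta_neg j ξ hξ).ne

theorem rt_ne (i : Idx p q) {ξ : ℝ} (hξ : 0 ≤ ξ) : D.rt i ξ ≠ 0 :=
  Complex.ofReal_ne_zero.2 (Real.sqrt_pos.2 (D.wt_pos i hξ)).ne'

theorem rt_aesm (i : Idx p q) : AEStronglyMeasurable (D.rt i) vol0 :=
  ((Complex.continuous_ofReal.comp_continuousOn
    (Real.continuous_sqrt.comp_continuousOn (D.wt_cont i))).mono
      Ioi_subset_Ici_self).aestronglyMeasurable measurableSet_Ioi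

theorem ae_pos : ∀ᵐ ξ ∂vol0, (0 : ℝ) < ξ := ae_restrict_mem measurableSet_Ioi

theorem form_eq_sum {ξ : ℝ} (hξ : 0 ≤ ξ) (x y : Idx p q → ℂ) :
    D.form ξ x y = ∑ i, star (D.rt i ξ * x i) * (D.rt i ξ * y i) := by
  unfold form act absDelta dotProduct
  refine Finset.sum_congr rfl fun i _ => ?_
  rw [Matrix.diagonal_map (Complex.ofReal_zero), Matrix.mulVec_diagonal]
  have h : (D.rt i ξ) * (D.rt i ξ) = ((D.wt i ξ : ℝ) : ℂ) := by
    unfold rt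
    rw [← Complex.ofReal_mul, Real.mul_self_sqrt (D.wt_pos i hξ).le]
  have h2 : star (D.rt i ξ) = D.rt i ξ := Complex.conj_ofReal _
  have h3 : ((Sum.elim (fun k => D.lam k ξ) (fun j => |D.theta j ξ|) i : ℝ) : ℂ)
    = (D.rt i ξ) * (D.rt i ξ) := h.symm
  simp only [Pi.star_apply, star_mul, h2]
  rw [h3]; ring

theorem form_self_re {ξ : ℝ} (hξ : 0 ≤ ξ) (x : Idx p q → ℂ) :
    (D.form ξ x x).re = ∑ i, ‖D.rt i ξ * x i‖ ^ 2 := by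
  rw [D.form_eq_sum hξ, Complex.re_sum]
  refine Finset.sum_congr rfl fun i _ => ?_
  have := Complex.conj_mul' (D.rt i ξ * x i)
  rw [Complex.star_def, this, ← Complex.ofReal_pow, Complex.ofReal_re]

theorem comp_aesm (x : ℝ →ₘ[vol0] (Idx p q → ℂ)) (i : Idx p q) :
    AEStronglyMeasurable (fun ξ => D.rt i ξ * x ξ i) vol0 :=
  (D.rt_aesm i).mul ((continuous_apply i).comp_aestronglyMeasurable x.aestronglyMeasurable)

/-- The condition `∫_0^∞ x^* |Δ| x dξ < ∞`. -/
def FiniteEnergy (x : ℝ →ₘ[vol0] (Idx p q → ℂ)) : Prop :=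
  ∫⁻ ξ, ENNReal.ofReal (D.form ξ (x ξ) (x ξ)).re ∂vol0 < ∞

theorem finiteEnergy_iff (x : ℝ →ₘ[vol0] (Idx p q → ℂ)) :
    D.FiniteEnergy x ↔ ∀ i, MemLp (fun ξ => D.rt i ξ * x ξ i) 2 vol0 := by
  have h1 : ∫⁻ ξ, ENNReal.ofReal (D.form ξ (x ξ) (x ξ)).re ∂vol0
      = ∑ i, ∫⁻ ξ, ENNReal.ofReal (‖D.rt i ξ * x ξ i‖ ^ 2) ∂vol0 := by
    rw [← lintegral_finsetSum']
    · refine lintegral_congr_ae ?_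
      filter_upwards [ae_pos] with ξ hξ
      rw [D.form_self_re hξ.le, ENNReal.ofReal_sum_of_nonneg]
      intros; positivity
    · intro i _
      exact ((D.comp_aesm x i).norm.aemeasurable.pow_const 2).ennreal_ofReal
  unfold FiniteEnergy
  rw [h1, ENNReal.sum_lt_top]
  refine ⟨fun h i => ?_, fun h i _ => ?_⟩
  · rw [memLp_two_iff_integrable_sq_norm (D.comp_aesm x i)]
    refine ⟨((D.comp_aesm x i).norm.pow 2), ?_⟩
    rw [hasFiniteIntegral_iff_ofReal (Eventually.of_forall fun ξ => by positivity)]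
    exact h i (Finset.mem_univ i)
  · have := (memLp_two_iff_integrable_sq_norm (D.comp_aesm x i)).1 (h i)
    have h2 := this.2
    rwa [hasFiniteIntegral_iff_ofReal (Eventually.of_forall fun ξ => by positivity)] at h2

/-! ## The Hilbert space `L²_{|Δ|}(0,∞)` -/

/-- `L²_{|Δ|}(0,∞)` as a space of (a.e. classes of) measurable functions. -/
def L2Sub : Submodule ℂ (ℝ →ₘ[vol0] (Idx p q → ℂ)) where
  carrier := {x | D.FiniteEnergy x}
  zero_mem' := by
    rw [mem_ofPred_eq, finiteEnergy_iff]
    intro i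
    refine (MemLp.zero' (p := 2) (μ := vol0) (ε := ℂ)).ae_eq ?_
    filter_upwards [AEEqFun.coeFn_zero (μ := vol0) (α := ℝ) (β := Idx p q → ℂ)] with ξ h
    rw [h]; simp
  add_mem' := by
    intro x y hx hy
    rw [mem_ofPred_eq, finiteEnergy_iff] at *
    intro i
    refine ((hx i).add (hy i)).ae_eq ?_
    filter_upwards [AEEqFun.coeFn_add x y] with ξ h
    rw [h]; simp [mul_add]
  smul_mem' := by
    intro c x hx
    rw [mem_ofPred_eq, finiteEnergy_iff] at *
    intro i
    refine ((hx i).const_smul c).ae_eq ?_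
    filter_upwards [AEEqFun.coeFn_smul c x] with ξ h
    rw [h]; simp [mul_left_comm]

/-- `L²_{|Δ|}(0,∞)`: all measurable `x` with values in `ℂ^n`, up to equality almost everywhere,
such that `∫_0^∞ x^* |Δ| x dξ < ∞`. -/
def L2 : Type := D.L2Sub

instance : AddCommGroup D.L2 := inferInstanceAs (AddCommGroup D.L2Sub)
instance : Module ℂ D.L2 := inferInstanceAs (Module ℂ D.L2Sub)

/-- The function underlying an element of `L²_{|Δ|}(0,∞)` (a representative). -/
def fn (x : D.L2) : ℝ → Idx p q → ℂ := (x.1 : ℝ →ₘ[vol0] (Idx p q → ℂ))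

theorem fn_add (x y : D.L2) : ∀ᵐ ξ ∂vol0, D.fn (x + y) ξ = D.fn x ξ + D.fn y ξ :=
  AEEqFun.coeFn_add x.1 y.1

theorem fn_smul (c : ℂ) (x : D.L2) : ∀ᵐ ξ ∂vol0, D.fn (c • x) ξ = c • D.fn x ξ :=
  AEEqFun.coeFn_smul c x.1

theorem fn_zero : ∀ᵐ ξ ∂vol0, D.fn (0 : D.L2) ξ = 0 :=
  AEEqFun.coeFn_zero (μ := vol0) (α := ℝ) (β := Idx p q → ℂ)

theorem ext_ae {x y : D.L2} (h : ∀ᵐ ξ ∂vol0, D.fn x ξ = D.fn y ξ) : x = y :=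
  Subtype.ext (AEEqFun.ext h)

theorem memLp_fn (x : D.L2) (i : Idx p q) : MemLp (fun ξ => D.rt i ξ * D.fn x ξ i) 2 vol0 :=
  (D.finiteEnergy_iff x.1).1 x.2 i

theorem integrable_term (x y : D.L2) (i : Idx p q) :
    Integrable (fun ξ => star (D.rt i ξ * D.fn x ξ i) * (D.rt i ξ * D.fn y ξ i)) vol0 :=
  (D.memLp_fn x i).star.integrable_mul (D.memLp_fn y i)

theorem integrable_form (x y : D.L2) :
    Integrable (fun ξ => D.form ξ (D.fn x ξ) (D.fn y ξ)) vol0 := by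
  refine (integrable_finsetSum Finset.univ fun i _ => D.integrable_term x y i).congr ?_
  filter_upwards [ae_pos] with ξ hξ
  rw [D.form_eq_sum hξ.le]

/-- The scalar product `⟨x, y⟩ = ∫_0^∞ x^* |Δ| y dξ`. -/
def innerL2 (x y : D.L2) : ℂ := ∫ ξ, D.form ξ (D.fn x ξ) (D.fn y ξ) ∂vol0

theorem re_innerL2_self (x : D.L2) :
    (D.innerL2 x x).re = ∫ ξ, (D.form ξ (D.fn x ξ) (D.fn x ξ)).re ∂vol0 :=
  (integral_re (𝕜 := ℂ) (D.integrable_form x x)).symm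

/-- The scalar product turns `L²_{|Δ|}(0,∞)` into a pre-Hilbert space. -/
@[reducible] def innerCore : InnerProductSpace.Core ℂ D.L2 where
  inner := D.innerL2
  conj_inner_symm x y := by
    unfold innerL2
    rw [← integral_conj]
    refine integral_congr_ae ?_
    filter_upwards [ae_pos] with ξ hξ
    rw [D.form_eq_sum hξ.le, D.form_eq_sum hξ.le, map_sum]
    refine Finset.sum_congr rfl fun i _ => ?_
    simp only [Complex.star_def, map_mul, Complex.conj_conj]
    ring
  re_inner_nonneg x := by
    change 0 ≤ (D.innerL2 x x).re
    rw [re_innerL2_self]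
    refine integral_nonneg_of_ae ?_
    filter_upwards [ae_pos] with ξ hξ
    rw [D.form_self_re hξ.le]
    exact Finset.sum_nonneg fun i _ => by positivity
  add_left x y z := by
    unfold innerL2
    rw [← integral_add (D.integrable_form x z) (D.integrable_form y z)]
    refine integral_congr_ae ?_
    filter_upwards [D.fn_add x y] with ξ h
    simp only [form, h, star_add, add_dotProduct]
  smul_left x y c := by
    unfold innerL2
    rw [← integral_const_mul]
    refine integral_congr_ae ?_
    filter_upwards [D.fn_smul c x] with ξ h
    simp only [form, h, star_smul, smul_dotProduct]
    rfl
  definite x hx := by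
    have h1 : (D.innerL2 x x).re = 0 := by
      rw [show D.innerL2 x x = 0 from hx]; rfl
    have hre : Integrable (fun ξ => (D.form ξ (D.fn x ξ) (D.fn x ξ)).re) vol0 :=
      (D.integrable_form x x).re
    rw [re_innerL2_self, integral_eq_zero_iff_of_nonneg_ae _ hre] at h1
    · refine D.ext_ae ?_
      filter_upwards [h1, ae_pos, D.fn_zero] with ξ h hξ h0
      have h' : (D.form ξ (D.fn x ξ) (D.fn x ξ)).re = 0 := h
      rw [D.form_self_re hξ.le, Finset.sum_eq_zero_iff_of_nonneg (fun i _ => by positivity)] at h'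
      rw [h0]
      funext i
      have h2 := h' i (Finset.mem_univ i)
      simpa [D.rt_ne i hξ.le] using h2
    · filter_upwards [ae_pos] with ξ hξ
      rw [D.form_self_re hξ.le]
      exact Finset.sum_nonneg fun i _ => by positivity

instance : NormedAddCommGroup D.L2 := D.innerCore.toNormedAddCommGroup
instance : InnerProductSpace ℂ D.L2 := InnerProductSpace.ofCore D.innerCore.toCore

theorem norm_sq_eq (x : D.L2) :
    ‖x‖ ^ 2 = ∫ ξ, (D.form ξ (D.fn x ξ) (D.fn x ξ)).re ∂vol0 := by
  rw [← re_innerL2_self]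
  exact (inner_self_eq_norm_sq (𝕜 := ℂ) x).symm

/-- `x ↦ |Δ|^{1/2} x`, as a linear map into a finite sum of unweighted `L²`-spaces. -/
def sqrtMap : D.L2 →ₗ[ℂ] PiLp 2 (fun _ : Idx p q => Lp ℂ 2 vol0) where
  toFun x := WithLp.toLp 2 fun i => (D.memLp_fn x i).toLp _
  map_add' x y := by
    ext i : 1
    refine Lp.ext ?_
    rw [PiLp.add_apply]
    filter_upwards [(D.memLp_fn (x + y) i).coeFn_toLp, (D.memLp_fn x i).coeFn_toLp,
      (D.memLp_fn y i).coeFn_toLp, Lp.coeFn_add ((D.memLp_fn x i).toLp _)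
        ((D.memLp_fn y i).toLp _), D.fn_add x y] with ξ h1 h2 h3 h4 h5
    rw [h1, h4, Pi.add_apply, h2, h3, h5, Pi.add_apply, mul_add]
  map_smul' c x := by
    ext i : 1
    refine Lp.ext ?_
    rw [PiLp.smul_apply]
    filter_upwards [(D.memLp_fn (c • x) i).coeFn_toLp, (D.memLp_fn x i).coeFn_toLp,
      Lp.coeFn_smul c ((D.memLp_fn x i).toLp _), D.fn_smul c x] with ξ h1 h2 h4 h5
    simp only [RingHom.id_apply]
    rw [h1, h4, Pi.smul_apply, h2, h5, Pi.smul_apply, smul_eq_mul, smul_eq_mul, mul_left_comm]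

theorem norm_sqrtMap (x : D.L2) : ‖D.sqrtMap x‖ = ‖x‖ := by
  have h : ‖D.sqrtMap x‖ ^ 2 = ‖x‖ ^ 2 := by
    rw [PiLp.norm_sq_eq_of_L2, norm_sq_eq]
    have h1 : ∀ i, ‖(D.sqrtMap x) i‖ ^ 2 = ∫ ξ, ‖D.rt i ξ * D.fn x ξ i‖ ^ 2 ∂vol0 := by
      intro i
      rw [← inner_self_eq_norm_sq (𝕜 := ℂ), L2.inner_def]
      rw [← integral_re (L2.integrable_inner _ _)]
      refine integral_congr_ae ?_
      filter_upwards [(D.memLp_fn x i).coeFn_toLp] with ξ h1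
      rw [inner_self_eq_norm_sq (𝕜 := ℂ)]
      exact congrArg (fun z : ℂ => ‖z‖ ^ 2) h1
    simp_rw [h1]
    rw [← integral_finsetSum]
    · refine integral_congr_ae ?_
      filter_upwards [ae_pos] with ξ hξ
      rw [D.form_self_re hξ.le]
    · intro i _
      exact (memLp_two_iff_integrable_sq_norm (D.memLp_fn x i).1).1 (D.memLp_fn x i)
  exact (sq_eq_sq₀ (norm_nonneg _) (norm_nonneg _)).1 h

theorem sqrtMap_surjective : Function.Surjective D.sqrtMap := by
  intro g
  have hm : AEStronglyMeasurable (fun ξ => fun i : Idx p q => (D.rt i ξ)⁻¹ * g i ξ) vol0 := by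
    refine AEMeasurable.aestronglyMeasurable (aemeasurable_pi_lambda _ fun i => ?_)
    exact (D.rt_aesm i).aemeasurable.inv.mul (Lp.aestronglyMeasurable (g i)).aemeasurable
  have key : ∀ i, (fun ξ => D.rt i ξ * (AEEqFun.mk _ hm : ℝ →ₘ[vol0] (Idx p q → ℂ)) ξ i)
      =ᵐ[vol0] g i := by
    intro i
    filter_upwards [AEEqFun.coeFn_mk _ hm, ae_pos] with ξ h hξ
    rw [h, mul_inv_cancel_left₀ (D.rt_ne i hξ.le)]
  have hmem : D.FiniteEnergy (AEEqFun.mk _ hm) := by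
    rw [finiteEnergy_iff]
    exact fun i => (Lp.memLp (g i)).ae_eq (key i).symm
  refine ⟨(⟨AEEqFun.mk _ hm, hmem⟩ : D.L2Sub), ?_⟩
  ext i : 1
  refine Lp.ext ?_
  exact ((D.memLp_fn (⟨AEEqFun.mk _ hm, hmem⟩ : D.L2Sub) i).coeFn_toLp).trans (key i)

/-- `L²_{|Δ|}(0,∞)` is a Hilbert space. -/
instance : CompleteSpace D.L2 :=
  have e : D.L2 ≃ₗᵢ[ℂ] PiLp 2 (fun _ : Idx p q => Lp ℂ 2 vol0) :=
    LinearIsometryEquiv.ofSurjective ⟨D.sqrtMap, D.norm_sqrtMap⟩ D.sqrtMap_surjective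
  (completeSpace_congr (e := e.toLinearEquiv.toEquiv) e.isometry.isUniformEmbedding).2 inferInstance

/-! ## The operator `A_Δ x = (Δ x)'` -/

end DiagCoeff

/-- `y` is locally absolutely continuous on `[0,∞)`. -/
def ACLoc {ι : Type*} [Fintype ι] (y : ℝ → ι → ℂ) : Prop :=
  ∀ a b : ℝ, 0 ≤ a → a ≤ b → AbsolutelyContinuousOnInterval y a b

theorem ACLoc.continuousOn {ι : Type*} [Fintype ι] {y : ℝ → ι → ℂ} (h : ACLoc y) :
    ContinuousOn y (Ioi 0) := by
  intro ξ hξ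
  have h1 := (h 0 (ξ + 1) le_rfl (by linarith [mem_Ioi.1 hξ])).continuousOn
  refine (h1.continuousAt ?_).continuousWithinAt
  rw [uIcc_of_le (by linarith [mem_Ioi.1 hξ])]
  exact Icc_mem_nhds hξ (by linarith)

namespace DiagCoeff

variable {p q : ℕ} (D : DiagCoeff p q)

/-- `Δ x` has the locally absolutely continuous representative `y` on `[0,∞)`, the derivative
(almost everywhere) `(Δ x)' = y'` is `z ∈ L²_{|Δ|}(0,∞)`, and `(Θ x)(0) = 0`. -/
def IsDerivVia (x z : D.L2) (y : ℝ → Idx p q → ℂ) : Prop :=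
  ACLoc y ∧ (∀ᵐ ξ ∂vol0, y ξ = act (D.Delta ξ) (D.fn x ξ)) ∧
    (∀ᵐ ξ ∂vol0, HasDerivAt y (D.fn z ξ) ξ) ∧ ∀ j : Fin q, y 0 (Sum.inr j) = 0

theorem IsDerivVia.unique {D : DiagCoeff p q} {x z z' : D.L2} {y y' : ℝ → Idx p q → ℂ}
    (h : D.IsDerivVia x z y) (h' : D.IsDerivVia x z' y') : z = z' := by
  have hy : EqOn y y' (Ioi 0) := by
    refine Measure.eqOn_open_of_ae_eq (μ := volume) ?_ isOpen_Ioi h.1.continuousOn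
      h'.1.continuousOn
    filter_upwards [h.2.1, h'.2.1] with ξ h1 h2
    rw [h1, h2]
  refine D.ext_ae ?_
  filter_upwards [h.2.2.1, h'.2.2.1, ae_pos] with ξ h1 h2 hξ
  have h3 : y =ᶠ[𝓝 ξ] y' := by
    filter_upwards [Ioi_mem_nhds hξ] with η hη using hy hη
  exact (h1.congr_of_eventuallyEq h3.symm).unique h2

theorem isDerivVia_zero : D.IsDerivVia 0 0 0 := by
  refine ⟨fun a b _ _ => ?_, ?_, ?_, fun j => rfl⟩
  · exact (LipschitzWith.const (0 : Idx p q → ℂ)).lipschitzOnWith.absolutelyContinuousOnInterval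
  · filter_upwards [D.fn_zero] with ξ h
    simp [h, act]
  · filter_upwards [D.fn_zero] with ξ h
    rw [h]
    exact hasDerivAt_const ξ (0 : Idx p q → ℂ)

theorem IsDerivVia.add {D : DiagCoeff p q} {x z x' z' : D.L2} {y y' : ℝ → Idx p q → ℂ}
    (h : D.IsDerivVia x z y) (h' : D.IsDerivVia x' z' y') :
    D.IsDerivVia (x + x') (z + z') (y + y') := by
  refine ⟨fun a b h1 h2 => (h.1 a b h1 h2).add (h'.1 a b h1 h2), ?_, ?_, fun j => ?_⟩
  · filter_upwards [h.2.1, h'.2.1, D.fn_add x x'] with ξ h1 h2 h3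
    rw [Pi.add_apply, h1, h2, h3, act, act, act, Matrix.mulVec_add]
  · filter_upwards [h.2.2.1, h'.2.2.1, D.fn_add z z'] with ξ h1 h2 h3
    rw [h3]
    exact h1.add h2
  · rw [Pi.add_apply, Pi.add_apply, h.2.2.2 j, h'.2.2.2 j, add_zero]

theorem IsDerivVia.smul {D : DiagCoeff p q} {x z : D.L2} {y : ℝ → Idx p q → ℂ} (c : ℂ)
    (h : D.IsDerivVia x z y) : D.IsDerivVia (c • x) (c • z) (c • y) := by
  refine ⟨fun a b h1 h2 => (h.1 a b h1 h2).const_smul c, ?_, ?_, fun j => ?_⟩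
  · filter_upwards [h.2.1, D.fn_smul c x] with ξ h1 h3
    rw [Pi.smul_apply, h1, h3, act, act, Matrix.mulVec_smul]
  · filter_upwards [h.2.2.1, D.fn_smul c z] with ξ h1 h3
    rw [h3]
    exact h1.const_smul c
  · rw [Pi.smul_apply, Pi.smul_apply, h.2.2.2 j, smul_zero]

/-- `D(A_Δ) = {x ∈ L²_{|Δ|}(0,∞) ; Δ x ∈ AC_loc[0,∞), (Δ x)' ∈ L²_{|Δ|}(0,∞), (Θ x)(0) = 0}`. -/
def domA : Submodule ℂ D.L2 where
  carrier := {x | ∃ (z : D.L2) (y : ℝ → Idx p q → ℂ), D.IsDerivVia x z y}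
  zero_mem' := ⟨0, 0, D.isDerivVia_zero⟩
  add_mem' := by
    rintro x x' ⟨z, y, h⟩ ⟨z', y', h'⟩
    exact ⟨z + z', y + y', h.add h'⟩
  smul_mem' := by
    rintro c x ⟨z, y, h⟩
    exact ⟨c • z, c • y, h.smul c⟩

/-- The operator `A_Δ x = (Δ x)'` with domain `D(A_Δ)`. -/
def opA : D.L2 →ₗ.[ℂ] D.L2 where
  domain := D.domA
  toFun :=
    { toFun := fun x => x.2.choose
      map_add' := fun x x' => by
        obtain ⟨y, h⟩ := x.2.choose_spec
        obtain ⟨y', h'⟩ := x'.2.choose_spec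
        obtain ⟨y'', h''⟩ := (x + x').2.choose_spec
        exact h''.unique (h.add h')
      map_smul' := fun c x => by
        obtain ⟨y, h⟩ := x.2.choose_spec
        obtain ⟨y'', h''⟩ := (c • x).2.choose_spec
        exact h''.unique (h.smul c) }

/-- `x ∈ D(A_Δ)` and `A_Δ x = z` if and only if `z` is the derivative `(Δ x)'`. -/
theorem opA_iff (x z : D.L2) :
    (∃ hx : x ∈ D.opA.domain, D.opA ⟨x, hx⟩ = z) ↔ ∃ y, D.IsDerivVia x z y := by
  constructor
  · rintro ⟨hx, rfl⟩
    exact hx.choose_spec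
  · rintro ⟨y, h⟩
    have hx : x ∈ D.opA.domain := ⟨z, y, h⟩
    obtain ⟨y', h'⟩ := Exists.choose_spec hx
    exact ⟨hx, h'.unique h⟩

end DiagCoeff

end DiagTransport

end

/-! Let `τᵢ(ξ) = ∫_0^ξ ds / |Δ(s)ᵢᵢ|` be the time a signal needs to travel from `0` to `ξ` along
the `i`-th characteristic. Since `1 / Δᵢᵢ` is not integrable, `τᵢ` maps `[0,∞)` onto `[0,∞)`, and
`x ↦ (|Δᵢᵢ| xᵢ) ∘ τᵢ⁻¹` is an isometry from the `i`-th coordinate of `L²_{|Δ|}(0,∞)` onto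
`L²(0,∞)`. It transforms `x ↦ (Δ x)'` into `± d/dτ`. This is the generator of the left translation
semigroup for the sign `+`, and, with the boundary condition at `0`, of the right translation
semigroup for the sign `-`; the semigroup generated by `A_Δ` is the one similar to their direct sum.

In order to identify the generator of a translation semigroup, the difference quotients are
integrated over `(0, b)`: their limit `g` satisfies `∫_0^b g = ± f(b) - c` for almost every `b`,
where the constant `c`, the limit of `(1/t) ∫_0^{±t} f`, is the flux through the boundary. -/

noncomputable section

namespace DiagTransport

section Semigroups

namespace C0Semigroup

variable {X Y : Type*} [NormedAddCommGroup X] [NormedSpace ℂ X]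
  [NormedAddCommGroup Y] [NormedSpace ℂ Y]

/-- The orbit of `x` has the right derivative `y` at time zero, that is, `(x, y)` lies in the graph
of the generator of `S`. -/
def HasOrbitDeriv (S : C0Semigroup X) (x y : X) : Prop :=
  Tendsto (fun t : ℝ≥0 => ((t : ℝ) : ℂ)⁻¹ • (S.T t x - x)) (𝓝[>] 0) (𝓝 y)

/-- The semigroup acting componentwise on a finite product. -/
def pi {ι : Type*} [Fintype ι] {X : ι → Type*} [∀ i, NormedAddCommGroup (X i)]
    [∀ i, NormedSpace ℂ (X i)] (S : ∀ i, C0Semigroup (X i)) : C0Semigroup (∀ i, X i) where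
  T t := ContinuousLinearMap.pi fun i => ((S i).T t).comp (ContinuousLinearMap.proj i)
  map_zero := by
    ext x i
    simp [(S i).map_zero]
  map_add s t := by
    ext x i
    simp [(S i).map_add]
  continuous_orbit x := continuous_pi fun i => (S i).continuous_orbit (x i)

theorem hasOrbitDeriv_pi {ι : Type*} [Fintype ι] {X : ι → Type*}
    [∀ i, NormedAddCommGroup (X i)] [∀ i, NormedSpace ℂ (X i)] {S : ∀ i, C0Semigroup (X i)}
    {x y : ∀ i, X i} : (pi S).HasOrbitDeriv x y ↔ ∀ i, (S i).HasOrbitDeriv (x i) (y i) :=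
  tendsto_pi_nhds

/-- The semigroup `e⁻¹ ∘ S ∘ e` similar to `S`. -/
def conj (e : X ≃L[ℂ] Y) (S : C0Semigroup Y) : C0Semigroup X where
  T t := (e.symm : Y →L[ℂ] X).comp ((S.T t).comp (e : X →L[ℂ] Y))
  map_zero := by
    ext x
    simp [S.map_zero]
  map_add s t := by
    ext x
    simp [S.map_add]
  continuous_orbit x := e.symm.continuous.comp (S.continuous_orbit (e x))

theorem hasOrbitDeriv_conj {e : X ≃L[ℂ] Y} {S : C0Semigroup Y} {x y : X} :
    (S.conj e).HasOrbitDeriv x y ↔ S.HasOrbitDeriv (e x) (e y) := by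
  have quotient_conj : e ∘ (fun t : ℝ≥0 => ((t : ℝ) : ℂ)⁻¹ • ((S.conj e).T t x - x))
      = fun t : ℝ≥0 => ((t : ℝ) : ℂ)⁻¹ • (S.T t (e x) - e x) := by
    funext t
    simp [conj]
  unfold HasOrbitDeriv
  rw [← quotient_conj]
  exact e.toHomeomorph.isInducing.tendsto_nhds_iff

end C0Semigroup

theorem tendsto_inv_smul_sub_of_hasDerivAt {X : Type*} [NormedAddCommGroup X] [NormedSpace ℂ X]
    {φ : ℝ → X} {φ' : X} (h : HasDerivAt φ φ' 0) :
    Tendsto (fun t : ℝ≥0 => ((t : ℝ) : ℂ)⁻¹ • (φ t - φ 0)) (𝓝[>] 0) (𝓝 φ') := by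
  have coe_tendsto : Tendsto ((↑) : ℝ≥0 → ℝ) (𝓝[>] 0) (𝓝[≠] 0) := by
    refine tendsto_nhdsWithin_iff.2 ⟨?_, ?_⟩
    · exact (NNReal.continuous_coe.tendsto' 0 0 rfl).mono_left nhdsWithin_le_nhds
    · filter_upwards [self_mem_nhdsWithin] with t ht
      exact (NNReal.coe_pos.2 ht).ne'
  refine (h.tendsto_slope.comp coe_tendsto).congr fun t => ?_
  rw [Function.comp_apply, slope_def_module, sub_zero, ← Complex.ofReal_inv, Complex.coe_smul]

theorem C0Semigroup.hasOrbitDeriv_of_sub_eq_integral {X : Type*} [NormedAddCommGroup X]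
    [NormedSpace ℂ X] [CompleteSpace X] {S : C0Semigroup X} {x y : X}
    (h : ∀ t : ℝ≥0, S.T t x - x = ∫ s in (0 : ℝ)..t, S.T s.toNNReal y) : S.HasOrbitDeriv x y := by
  have orbit_cont : Continuous fun s : ℝ => S.T s.toNNReal y :=
    (S.continuous_orbit y).comp continuous_real_toNNReal
  have deriv_zero : HasDerivAt (fun r : ℝ => ∫ s in (0 : ℝ)..r, S.T s.toNNReal y) y 0 := by
    simpa [S.map_zero] using orbit_cont.integral_hasStrictDerivAt 0 0 |>.hasDerivAt
  refine (tendsto_inv_smul_sub_of_hasDerivAt deriv_zero).congr fun t => ?_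
  rw [intervalIntegral.integral_same, sub_zero, h]

end Semigroups

section Shift

variable {E : Type*} [NormedAddCommGroup E] {p : ℝ≥0∞}

theorem ae_add_right {P : ℝ → Prop} (h : ∀ᵐ τ : ℝ, P τ) (a : ℝ) : ∀ᵐ τ : ℝ, P (τ + a) :=
  (measurePreserving_add_right volume a).quasiMeasurePreserving.ae h

theorem memLp_indicator_Ioi (f : Lp E p vol0) : MemLp ((Ioi 0).indicator f) p volume :=
  (memLp_indicator_iff_restrict measurableSet_Ioi).2 (Lp.memLp f)

variable [NormedSpace ℂ E] [Fact (1 ≤ p)]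

/-- Extension by zero from `(0,∞)` to `ℝ`. -/
def zeroExt : Lp E p vol0 →ₗᵢ[ℂ] Lp E p (volume : Measure ℝ) where
  toFun f := (memLp_indicator_Ioi f).toLp _
  map_add' f g := by
    rw [← MemLp.toLp_add]
    refine MemLp.toLp_congr _ _ (((ae_eq_restrict_iff_indicator_ae_eq measurableSet_Ioi).1
      (Lp.coeFn_add f g)).trans ?_)
    exact (indicator_add _ _ _).eventuallyEq
  map_smul' c f := by
    rw [RingHom.id_apply, ← MemLp.toLp_const_smul]
    refine MemLp.toLp_congr _ _ (((ae_eq_restrict_iff_indicator_ae_eq measurableSet_Ioi).1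
      (Lp.coeFn_smul c f)).trans ?_)
    exact (indicator_const_smul _ _ _).eventuallyEq
  norm_map' f := by
    change ‖(memLp_indicator_Ioi f).toLp _‖ = ‖f‖
    rw [Lp.norm_toLp, eLpNorm_indicator_eq_eLpNorm_restrict measurableSet_Ioi, Lp.norm_def]

theorem coeFn_zeroExt (f : Lp E p vol0) : zeroExt f =ᵐ[volume] (Ioi 0).indicator f :=
  (memLp_indicator_Ioi f).coeFn_toLp

/-- The translation `f ↦ f(· + a)` on `Lᵖ(ℝ)`. -/
def translate (a : ℝ) : Lp E p (volume : Measure ℝ) →ₗᵢ[ℂ] Lp E p (volume : Measure ℝ) :=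
  Lp.compMeasurePreservingₗᵢ ℂ (· + a) (measurePreserving_add_right volume a)

theorem coeFn_translate (a : ℝ) (f : Lp E p (volume : Measure ℝ)) :
    translate a f =ᵐ[volume] fun τ => f (τ + a) :=
  Lp.coeFn_compMeasurePreserving f (measurePreserving_add_right volume a)

theorem continuous_translate (hp : p ≠ ∞) (f : Lp E p (volume : Measure ℝ)) :
    Continuous fun a => translate a f := by
  let addMap : C(ℝ × ℝ, ℝ) := ⟨fun x => x.2 + x.1, by fun_prop⟩
  exact Continuous.compMeasurePreservingLp (g := fun a : ℝ => addMap.curry a)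
    continuous_const addMap.curry.continuous (measurePreserving_add_right volume) hp

/-- The translation `f ↦ f(· + a)` on `Lᵖ(0,∞)`, functions being extended by zero. -/
def shift (a : ℝ) : Lp E p vol0 →L[ℂ] Lp E p vol0 :=
  (LpToLpRestrictCLM ℝ E ℂ volume p (Ioi 0)).comp
    ((translate a).comp zeroExt).toContinuousLinearMap

theorem continuous_shift (hp : p ≠ ∞) (f : Lp E p vol0) : Continuous fun a => shift a f :=
  (LpToLpRestrictCLM ℝ E ℂ volume p (Ioi 0)).continuous.comp (continuous_translate hp (zeroExt f))

theorem coeFn_shift (a : ℝ) (f : Lp E p vol0) :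
    shift a f =ᵐ[vol0] fun τ => (Ioi 0).indicator f (τ + a) := by
  refine (LpToLpRestrictCLM_coeFn ℂ (Ioi 0) (translate a (zeroExt f))).trans
    (ae_restrict_of_ae ?_)
  filter_upwards [coeFn_translate a (zeroExt f), ae_add_right (coeFn_zeroExt f) a]
    with τ h_translate h_ext
  rw [h_translate, h_ext]

theorem shift_zero : shift 0 = ContinuousLinearMap.id ℂ (Lp E p vol0) := by
  ext1 f
  refine Lp.ext ?_
  filter_upwards [coeFn_shift 0 f, DiagCoeff.ae_pos] with τ h hτ
  rw [h, add_zero, indicator_of_mem (mem_Ioi.2 hτ), ContinuousLinearMap.id_apply]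

/-- The excluded case is that of a left translation followed by a right one, which puts zeros in
the place of the values lost at the boundary. -/
theorem shift_comp_shift {a b : ℝ} (hab : 0 ≤ a ∨ b ≤ 0) :
    (shift a).comp (shift b) = (shift (a + b) : Lp E p vol0 →L[ℂ] Lp E p vol0) := by
  ext1 f
  refine Lp.ext ?_
  filter_upwards [coeFn_shift a (shift b f), coeFn_shift (a + b) f,
    ae_restrict_of_ae (ae_add_right ((ae_restrict_iff' measurableSet_Ioi).1 (coeFn_shift b f)) a),
    DiagCoeff.ae_pos]
    with τ h_left h_right h_inner hτ
  rw [ContinuousLinearMap.comp_apply, h_left, h_right, ← add_assoc]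
  by_cases hτa : 0 < τ + a
  · rw [indicator_of_mem (mem_Ioi.2 hτa), h_inner hτa]
  · rw [indicator_of_notMem (mt mem_Ioi.1 hτa), indicator_of_notMem]
    rcases hab with ha | hb
    · exact absurd (by positivity) hτa
    · exact fun h => hτa (by linarith [mem_Ioi.1 h])

/-- Translation with speed `σ` on `Lᵖ(0,∞)`: to the left if `σ > 0`, and to the right, with zeros
entering at the boundary, if `σ < 0`. -/
def shiftSemigroup (E : Type*) [NormedAddCommGroup E] [NormedSpace ℂ E] {p : ℝ≥0∞} [Fact (1 ≤ p)]
    (hp : p ≠ ∞) (σ : ℝ) : C0Semigroup (Lp E p vol0) where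
  T t := shift (σ * t)
  map_zero := by rw [NNReal.coe_zero, mul_zero, shift_zero]
  map_add s t := by
    rw [shift_comp_shift, NNReal.coe_add, mul_add]
    rcases le_total 0 σ with hσ | hσ
    · exact Or.inl (by positivity)
    · exact Or.inr (mul_nonpos_of_nonpos_of_nonneg hσ t.2)
  continuous_orbit f := (continuous_shift hp f).comp (by fun_prop)

end Shift

section Primitive

variable {E : Type*} [NormedAddCommGroup E] {p : ℝ≥0∞}

theorem memLp_restrict_Ioc (f : Lp E p vol0) (b : ℝ) : MemLp f p (volume.restrict (Ioc 0 b)) :=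
  (Lp.memLp f).mono_measure (Measure.restrict_mono_set volume Ioc_subset_Ioi_self)

theorem intervalIntegrable_indicator_Ioi [Fact (1 ≤ p)] (f : Lp E p vol0) (a b : ℝ) :
    IntervalIntegrable ((Ioi 0).indicator f) volume a b :=
  (((memLp_indicator_Ioi f).locallyIntegrable Fact.out).integrableOn_isCompact
    isCompact_uIcc).intervalIntegrable

variable [NormedSpace ℂ E]

/-- The primitive of `f ∈ Lᵖ(0,∞)` which vanishes on `(-∞,0]`. -/
def primitive (f : Lp E p vol0) (b : ℝ) : E := ∫ τ in (0 : ℝ)..b, (Ioi 0).indicator f τ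

theorem primitive_of_nonpos (f : Lp E p vol0) {b : ℝ} (hb : b ≤ 0) : primitive f b = 0 := by
  refine intervalIntegral.integral_zero_ae (Eventually.of_forall fun τ hτ => ?_)
  rw [uIoc_of_ge hb] at hτ
  exact indicator_of_notMem (notMem_Ioi.2 hτ.2) _

theorem primitive_eq_setIntegral (f : Lp E p vol0) {b : ℝ} (hb : 0 ≤ b) :
    primitive f b = ∫ τ in Ioc 0 b, f τ := by
  rw [primitive, intervalIntegral.integral_of_le hb, setIntegral_indicator measurableSet_Ioi,
    inter_eq_left.2 Ioc_subset_Ioi_self]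

theorem primitive_congr_ae {f : Lp E p vol0} {F : ℝ → E} {b : ℝ} (hb : 0 ≤ b)
    (h : f =ᵐ[vol0] F) : primitive f b = ∫ τ in (0 : ℝ)..b, F τ := by
  refine intervalIntegral.integral_congr_ae ?_
  filter_upwards [(ae_restrict_iff' measurableSet_Ioi).1 h] with τ hτ hτb
  rw [uIoc_of_le hb] at hτb
  rw [indicator_of_mem (mem_Ioi.2 hτb.1), hτ hτb.1]

variable [Fact (1 ≤ p)]

theorem integral_indicator_Ioi (f : Lp E p vol0) (a b : ℝ) :
    ∫ τ in a..b, (Ioi 0).indicator f τ = primitive f b - primitive f a :=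
  (intervalIntegral.integral_interval_sub_left (intervalIntegrable_indicator_Ioi f 0 b)
    (intervalIntegrable_indicator_Ioi f 0 a)).symm

theorem continuous_primitive (f : Lp E p vol0) : Continuous (primitive f) :=
  intervalIntegral.continuous_primitive (intervalIntegrable_indicator_Ioi f) 0

theorem ae_hasDerivAt_primitive [CompleteSpace E] (f : Lp E p vol0) :
    ∀ᵐ τ ∂vol0, HasDerivAt (primitive f) (f τ) τ := by
  have deriv_ae := LocallyIntegrable.ae_hasDerivAt_integral
    ((memLp_indicator_Ioi f).locallyIntegrable Fact.out)
  filter_upwards [ae_restrict_of_ae deriv_ae, DiagCoeff.ae_pos] with τ h hτ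
  rw [← indicator_of_mem (mem_Ioi.2 hτ) f]
  exact h 0

theorem eq_of_primitive_eq [CompleteSpace E] {f g : Lp E p vol0}
    (h : ∀ b, 0 ≤ b → primitive f b = primitive g b) : f = g := by
  have primitive_eq : primitive f = primitive g := by
    funext b
    rcases le_total 0 b with hb | hb
    · exact h b hb
    · rw [primitive_of_nonpos f hb, primitive_of_nonpos g hb]
  refine Lp.ext ?_
  filter_upwards [ae_hasDerivAt_primitive f, ae_hasDerivAt_primitive g] with τ hf hg
  exact hf.unique (primitive_eq ▸ hg)

theorem norm_primitive_le (f : Lp E p vol0) {b : ℝ} (hb : 0 ≤ b) :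
    ‖primitive f b‖ ≤ b ^ (1 - 1 / p.toReal) * ‖f‖ := by
  set ν := volume.restrict (Ioc 0 b)
  have exponent_nonneg : 0 ≤ 1 - 1 / p.toReal := by
    rcases eq_or_ne p ∞ with rfl | hp
    · simp
    · have : 1 ≤ p.toReal := ENNReal.toReal_mono hp (Fact.out : 1 ≤ p)
      rw [sub_nonneg, div_le_one (by positivity)]
      exact this
  have enorm_le : ‖primitive f b‖ₑ ≤ eLpNorm f p vol0 * ENNReal.ofReal b ^ (1 - 1 / p.toReal) :=
    calc ‖primitive f b‖ₑ ≤ eLpNorm f 1 ν := by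
          rw [primitive_eq_setIntegral f hb, eLpNorm_one_eq_lintegral_enorm]
          exact enorm_integral_le_lintegral_enorm _
      _ ≤ eLpNorm f p ν * ν univ ^ (1 - 1 / p.toReal) := by
          simpa only [ENNReal.toReal_one, div_one] using
            eLpNorm_le_eLpNorm_mul_rpow_measure_univ (Fact.out : 1 ≤ p)
              (memLp_restrict_Ioc f b).aestronglyMeasurable
      _ ≤ eLpNorm f p vol0 * ENNReal.ofReal b ^ (1 - 1 / p.toReal) := by
          rw [Measure.restrict_apply_univ, Real.volume_Ioc, sub_zero]
          gcongr
          exact Measure.restrict_mono_set volume Ioc_subset_Ioi_self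
  rw [ENNReal.ofReal_rpow_of_nonneg hb exponent_nonneg] at enorm_le
  have := ENNReal.toReal_mono (by finiteness [Lp.eLpNorm_ne_top f]) enorm_le
  rwa [toReal_enorm, ENNReal.toReal_mul, ENNReal.toReal_ofReal (by positivity), ← Lp.norm_def,
    mul_comm] at this

variable (E p) in
/-- The functional `f ↦ ∫_0^b f`, where `b ≥ 0`. -/
def primitiveCLM {b : ℝ} (hb : 0 ≤ b) : Lp E p vol0 →L[ℂ] E :=
  LinearMap.mkContinuous
    { toFun := fun f => primitive f b
      map_add' := fun f g => by
        simp only [primitive_eq_setIntegral _ hb]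
        rw [integral_congr_ae
          (ae_restrict_of_ae_restrict_of_subset Ioc_subset_Ioi_self (Lp.coeFn_add f g))]
        exact integral_add ((memLp_restrict_Ioc f b).integrable Fact.out)
          ((memLp_restrict_Ioc g b).integrable Fact.out)
      map_smul' := fun c f => by
        simp only [primitive_eq_setIntegral _ hb]
        rw [integral_congr_ae
          (ae_restrict_of_ae_restrict_of_subset Ioc_subset_Ioi_self (Lp.coeFn_smul c f))]
        exact integral_smul c _ }
    (b ^ (1 - 1 / p.toReal)) fun f => norm_primitive_le f hb

theorem primitive_shift (f : Lp E p vol0) (a : ℝ) {b : ℝ} (hb : 0 ≤ b) :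
    primitive (shift a f) b = primitive f (b + a) - primitive f a := by
  rw [primitive_congr_ae hb (coeFn_shift a f), intervalIntegral.integral_comp_add_right
    (fun τ => (Ioi (0 : ℝ)).indicator f τ), zero_add, integral_indicator_Ioi]

end Primitive

section ShiftGenerator

variable {E : Type*} [NormedAddCommGroup E] [NormedSpace ℂ E] {p : ℝ≥0∞}

/-- The derivative of `σ f` is `g`, with boundary value zero at the origin if `σ < 0`. -/
def HasTransportDeriv (σ : ℝ) (f g : Lp E p vol0) : Prop :=
  ∃ c : E, (σ < 0 → c = 0) ∧ ∀ᵐ τ ∂vol0, σ • f τ = c + primitive g τ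

variable [Fact (1 ≤ p)] {σ : ℝ} {f g : Lp E p vol0}

theorem primitive_sub_primitive_of_ae {c : E} (hσ : σ ≠ 0) (hc : σ < 0 → c = 0)
    (h : ∀ᵐ τ ∂vol0, σ • f τ = c + primitive g τ) {b t : ℝ} (hb : 0 ≤ b) (ht : 0 ≤ t) :
    primitive f (b + σ * t) - primitive f b = ∫ s in (0 : ℝ)..t, (c + primitive g (b + σ * s)) := by
  have integrand_ae : ∀ᵐ τ, τ ∈ uIoc b (b + σ * t) →
      σ • (Ioi 0).indicator f τ = c + primitive g τ := by
    filter_upwards [(ae_restrict_iff' measurableSet_Ioi).1 h] with τ h_pos hτ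
    by_cases hτ0 : 0 < τ
    · rw [indicator_of_mem (mem_Ioi.2 hτ0), h_pos hτ0]
    · have hσ_neg : σ < 0 := by
        by_contra! hσ0
        rw [uIoc_of_le (by nlinarith)] at hτ
        exact hτ0 (hb.trans_lt hτ.1)
      rw [indicator_of_notMem (mt mem_Ioi.1 hτ0), smul_zero, hc hσ_neg,
        primitive_of_nonpos g (not_lt.1 hτ0), add_zero]
  refine smul_right_injective E hσ ?_
  change σ • _ = σ • _
  rw [← integral_indicator_Ioi, ← intervalIntegral.integral_smul,
    intervalIntegral.integral_congr_ae integrand_ae,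
    intervalIntegral.smul_integral_comp_add_mul (fun τ => c + primitive g τ), mul_zero, add_zero]

variable [CompleteSpace E] {hp : p ≠ ∞}

/-- Integrating the difference quotient over `(0, b)` isolates the mass entering at the boundary. -/
theorem ae_tendsto_primitive_boundary (h : (shiftSemigroup E hp σ).HasOrbitDeriv f g) :
    ∀ᵐ b ∂vol0, Tendsto (fun t : ℝ≥0 => ((t : ℝ) : ℂ)⁻¹ • primitive f (σ * t)) (𝓝[>] 0)
      (𝓝 (σ • f b - primitive g b)) := by
  filter_upwards [ae_hasDerivAt_primitive f, DiagCoeff.ae_pos] with b deriv_b hb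
  have deriv_shifted : HasDerivAt (fun t : ℝ => primitive f (b + σ * t)) (σ • f b) 0 := by
    have inner_deriv : HasDerivAt (fun t : ℝ => b + σ * t) σ 0 := by
      simpa using ((hasDerivAt_id (0 : ℝ)).const_mul σ).const_add b
    exact HasDerivAt.scomp (0 : ℝ) (by simpa using deriv_b) inner_deriv
  have tendsto_primitive := ((primitiveCLM E p hb.le).continuous.tendsto g).comp h
  refine ((tendsto_inv_smul_sub_of_hasDerivAt deriv_shifted).sub tendsto_primitive).congr
    fun t => ?_
  have primitive_quotient : primitiveCLM E p hb.le (shift (σ * t) f - f)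
      = primitive f (b + σ * t) - primitive f (σ * t) - primitive f b := by
    rw [map_sub]
    exact congrArg (· - primitive f b) (primitive_shift f (σ * t) hb.le)
  change _ - primitiveCLM E p hb.le (((t : ℝ) : ℂ)⁻¹ • (shift (σ * t) f - f)) = _
  rw [map_smul, primitive_quotient, ← smul_sub, mul_zero, add_zero]
  congr 1
  abel

theorem HasTransportDeriv.of_hasOrbitDeriv (h : (shiftSemigroup E hp σ).HasOrbitDeriv f g) :
    HasTransportDeriv σ f g := by
  have boundary := ae_tendsto_primitive_boundary h
  have : NeBot (ae vol0) := ae_neBot.2 (by simp [vol0])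
  obtain ⟨b, tendsto_b⟩ := boundary.exists
  refine ⟨σ • f b - primitive g b, fun hσ => ?_, ?_⟩
  · refine tendsto_nhds_unique tendsto_b (tendsto_const_nhds.congr fun t => ?_)
    rw [primitive_of_nonpos f (mul_nonpos_of_nonpos_of_nonneg hσ.le t.coe_nonneg), smul_zero]
  · filter_upwards [boundary] with τ tendsto_τ
    rw [tendsto_nhds_unique tendsto_b tendsto_τ, sub_add_cancel]

theorem HasTransportDeriv.shift_sub_self (hp : p ≠ ∞) (hσ : σ ≠ 0) (h : HasTransportDeriv σ f g)
    {t : ℝ} (ht : 0 ≤ t) : shift (σ * t) f - f = ∫ s in (0 : ℝ)..t, shift (σ * s) g := by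
  obtain ⟨c, hc, h_ae⟩ := h
  have shift_cont : Continuous fun s => shift (σ * s) g :=
    (continuous_shift hp g).comp (continuous_const_mul σ)
  have integrable_primitive (b : ℝ) :
      IntervalIntegrable (fun s => c + primitive g (b + σ * s)) volume 0 t :=
    Continuous.intervalIntegrable
      (continuous_const.add ((continuous_primitive g).comp (by fun_prop))) 0 t
  refine eq_of_primitive_eq fun b hb => ?_
  calc primitiveCLM E p hb (shift (σ * t) f - f)
      = (primitive f (b + σ * t) - primitive f b)
          - (primitive f (0 + σ * t) - primitive f 0) := by
        rw [map_sub, zero_add, primitive_of_nonpos f le_rfl, sub_zero, sub_right_comm]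
        exact congrArg (· - primitive f b) (primitive_shift f (σ * t) hb)
    _ = ∫ s in (0 : ℝ)..t, (primitive g (b + σ * s) - primitive g (σ * s)) := by
        rw [primitive_sub_primitive_of_ae hσ hc h_ae hb ht,
          primitive_sub_primitive_of_ae hσ hc h_ae le_rfl ht,
          ← intervalIntegral.integral_sub (integrable_primitive b) (integrable_primitive 0)]
        simp only [zero_add, add_sub_add_left_eq_sub]
    _ = ∫ s in (0 : ℝ)..t, primitiveCLM E p hb (shift (σ * s) g) :=
        intervalIntegral.integral_congr fun s _ => (primitive_shift g (σ * s) hb).symm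
    _ = primitiveCLM E p hb (∫ s in (0 : ℝ)..t, shift (σ * s) g) :=
        (primitiveCLM E p hb).intervalIntegral_comp_comm (shift_cont.intervalIntegrable 0 t)

theorem hasOrbitDeriv_shiftSemigroup_iff (hσ : σ ≠ 0) :
    (shiftSemigroup E hp σ).HasOrbitDeriv f g ↔ HasTransportDeriv σ f g := by
  refine ⟨HasTransportDeriv.of_hasOrbitDeriv,
    fun h => C0Semigroup.hasOrbitDeriv_of_sub_eq_integral fun t => ?_⟩
  refine (h.shift_sub_self hp hσ t.2).trans (intervalIntegral.integral_congr fun s hs => ?_)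
  rw [uIcc_of_le t.2] at hs
  exact congrArg (fun r => shift (σ * r) g) (Real.coe_toNNReal s hs.1).symm

end ShiftGenerator

section WeightedComposition

variable {α β 𝕜 E : Type*} [MeasurableSpace α] [MeasurableSpace β] {μ : Measure α} {ν : Measure β}
  [NormedField 𝕜] {p : ℝ≥0∞} {m : α → 𝕜} {e : α ≃ᵐ β}

/-- The almost everywhere nonzero weight `m` compensates the change of variables `e`: the measure
`|m|ᵖ μ` is transformed by `e` into `ν`, so that `h ↦ m • (h ∘ e)` is isometric from `Lᵖ(ν)` onto
`Lᵖ(μ)`. -/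
structure IsCompWeight (p : ℝ≥0∞) (m : α → 𝕜) (e : α ≃ᵐ β) (μ : Measure α) (ν : Measure β) :
    Prop where
  aestronglyMeasurable : AEStronglyMeasurable m μ
  ae_ne_zero : ∀ᵐ x ∂μ, m x ≠ 0
  measurePreserving : MeasurePreserving e (μ.withDensity fun x => ‖m x‖ₑ ^ p.toReal) ν

namespace IsCompWeight

theorem absolutelyContinuous (hm : IsCompWeight p m e μ ν) :
    μ ≪ μ.withDensity fun x => ‖m x‖ₑ ^ p.toReal := by
  refine withDensity_absolutelyContinuous' (hm.aestronglyMeasurable.enorm.pow_const _) ?_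
  filter_upwards [hm.ae_ne_zero] with x hx
  simp [ENNReal.rpow_eq_zero_iff, hx]

theorem ae_comp_iff (hm : IsCompWeight p m e μ ν) {P : β → Prop} :
    (∀ᵐ x ∂μ, P (e x)) ↔ ∀ᵐ y ∂ν, P y := by
  rw [← hm.measurePreserving.map_eq, e.measurableEmbedding.ae_map_iff]
  exact ⟨fun h => (withDensity_absolutelyContinuous μ _).ae_le h,
    fun h => hm.absolutelyContinuous.ae_le h⟩

variable [NormedAddCommGroup E] [NormedSpace 𝕜 E]

theorem aestronglyMeasurable_smul_comp (hm : IsCompWeight p m e μ ν) {h : β → E}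
    (hh : AEStronglyMeasurable h ν) : AEStronglyMeasurable (fun x => m x • h (e x)) μ :=
  hm.aestronglyMeasurable.smul
    ((hh.comp_measurePreserving hm.measurePreserving).mono_ac hm.absolutelyContinuous)

theorem eLpNorm_smul_comp (hm : IsCompWeight p m e μ ν) (hp0 : p ≠ 0) (hp : p ≠ ∞) (h : β → E) :
    eLpNorm (fun x => m x • h (e x)) p μ = eLpNorm h p ν := by
  have density_ae : AEMeasurable (fun x => ‖m x‖ₑ ^ p.toReal) μ :=
    hm.aestronglyMeasurable.enorm.pow_const _
  have density_lt_top : ∀ᵐ x ∂μ, ‖m x‖ₑ ^ p.toReal < ∞ :=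
    Eventually.of_forall fun x => ENNReal.rpow_lt_top_of_nonneg ENNReal.toReal_nonneg enorm_ne_top
  rw [eLpNorm_eq_lintegral_rpow_enorm_toReal hp0 hp, eLpNorm_eq_lintegral_rpow_enorm_toReal hp0 hp,
    ← hm.measurePreserving.lintegral_comp_emb e.measurableEmbedding,
    lintegral_withDensity_eq_lintegral_mul_non_measurable₀ μ density_ae density_lt_top]
  simp only [Pi.mul_apply, enorm_smul, ENNReal.mul_rpow_of_nonneg _ _ ENNReal.toReal_nonneg]

variable [Fact (1 ≤ p)]

theorem memLp_smul_comp (hm : IsCompWeight p m e μ ν) (hp : p ≠ ∞) (h : Lp E p ν) :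
    MemLp (fun x => m x • h (e x)) p μ := by
  refine ⟨hm.aestronglyMeasurable_smul_comp (Lp.aestronglyMeasurable h), ?_⟩
  rw [hm.eLpNorm_smul_comp (zero_lt_one.trans_le Fact.out).ne' hp]
  exact Lp.eLpNorm_lt_top h

variable (E) in
/-- The isometry `h ↦ m • (h ∘ e)` from `Lᵖ(ν)` to `Lᵖ(μ)`. -/
def weightedComp (hm : IsCompWeight p m e μ ν) (hp : p ≠ ∞) : Lp E p ν →ₗᵢ[𝕜] Lp E p μ where
  toFun h := (hm.memLp_smul_comp hp h).toLp _
  map_add' h k := by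
    rw [← MemLp.toLp_add]
    refine MemLp.toLp_congr _ _ ?_
    filter_upwards [hm.ae_comp_iff.2 (Lp.coeFn_add h k)] with x hx
    rw [hx, Pi.add_apply, Pi.add_apply, smul_add]
  map_smul' c h := by
    rw [RingHom.id_apply, ← MemLp.toLp_const_smul]
    refine MemLp.toLp_congr _ _ ?_
    filter_upwards [hm.ae_comp_iff.2 (Lp.coeFn_smul c h)] with x hx
    rw [hx, Pi.smul_apply, Pi.smul_apply, smul_comm]
  norm_map' h := by
    change ‖(hm.memLp_smul_comp hp h).toLp _‖ = ‖h‖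
    rw [Lp.norm_toLp, hm.eLpNorm_smul_comp (zero_lt_one.trans_le Fact.out).ne' hp, Lp.norm_def]

theorem coeFn_weightedComp (hm : IsCompWeight p m e μ ν) (hp : p ≠ ∞) (h : Lp E p ν) :
    hm.weightedComp E hp h =ᵐ[μ] fun x => m x • h (e x) :=
  (hm.memLp_smul_comp hp h).coeFn_toLp

theorem surjective_weightedComp (hm : IsCompWeight p m e μ ν) (hp : p ≠ ∞) :
    Function.Surjective (hm.weightedComp E hp) := by
  intro g
  set h : β → E := fun y => (m (e.symm y))⁻¹ • g (e.symm y)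
  have smul_h_comp : (fun x => m x • h (e x)) =ᵐ[μ] g := by
    filter_upwards [hm.ae_ne_zero] with x hx
    simp only [h, e.symm_apply_apply, smul_inv_smul₀ hx]
  have h_memLp : MemLp h p ν := by
    refine ⟨?_, ?_⟩
    · exact ((hm.aestronglyMeasurable.inv₀.smul (Lp.aestronglyMeasurable g)).mono_ac
        (withDensity_absolutelyContinuous _ _)).comp_measurePreserving (hm.measurePreserving.symm e)
    · rw [← hm.eLpNorm_smul_comp (zero_lt_one.trans_le Fact.out).ne' hp,
        eLpNorm_congr_ae smul_h_comp]
      exact Lp.eLpNorm_lt_top g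
  refine ⟨h_memLp.toLp h, Lp.ext ?_⟩
  filter_upwards [hm.coeFn_weightedComp hp (h_memLp.toLp h), hm.ae_comp_iff.2 h_memLp.coeFn_toLp,
    smul_h_comp] with x h_weighted h_toLp h_smul
  rw [h_weighted, h_toLp, h_smul]

variable (E) in
/-- The isometric isomorphism `h ↦ m • (h ∘ e)` from `Lᵖ(ν)` onto `Lᵖ(μ)`. -/
def weightedCompEquiv (hm : IsCompWeight p m e μ ν) (hp : p ≠ ∞) : Lp E p ν ≃ₗᵢ[𝕜] Lp E p μ :=
  LinearIsometryEquiv.ofSurjective (hm.weightedComp E hp) (hm.surjective_weightedComp hp)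

end IsCompWeight

end WeightedComposition

section TravelTime

/-- A positive continuous speed on `[0,∞)` with which no finite time suffices to travel along the
whole half-line. -/
structure IsCompleteSpeed (v : ℝ → ℝ) : Prop where
  continuousOn : ContinuousOn v (Ici 0)
  pos : ∀ ξ, 0 ≤ ξ → 0 < v ξ
  not_integrableOn_inv : ¬ IntegrableOn (fun ξ => (v ξ)⁻¹) (Ioi 0)

/-- The reciprocal of the speed `v`, extended from `[0,∞)` to `ℝ` by its value at `0`. -/
def slowness (v : ℝ → ℝ) (ξ : ℝ) : ℝ := (v (max ξ 0))⁻¹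

/-- The time it takes to travel from `0` to `ξ` with speed `v`. For `ξ < 0` the speed is `v 0`, so
that the travel time is a bijection of `ℝ`. -/
def travelTime (v : ℝ → ℝ) (ξ : ℝ) : ℝ := ∫ s in (0 : ℝ)..ξ, slowness v s

theorem slowness_of_nonneg (v : ℝ → ℝ) {ξ : ℝ} (hξ : 0 ≤ ξ) : slowness v ξ = (v ξ)⁻¹ := by
  rw [slowness, max_eq_left hξ]

theorem travelTime_of_nonpos (v : ℝ → ℝ) {ξ : ℝ} (hξ : ξ ≤ 0) :
    travelTime v ξ = ξ * (v 0)⁻¹ := by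
  have slowness_eq : EqOn (slowness v) (fun _ => (v 0)⁻¹) (uIcc 0 ξ) := fun s hs => by
    rw [uIcc_of_ge hξ] at hs
    rw [slowness, max_eq_right hs.2]
  rw [travelTime, intervalIntegral.integral_congr slowness_eq, intervalIntegral.integral_const,
    sub_zero, smul_eq_mul]

namespace IsCompleteSpeed

variable {v : ℝ → ℝ}

theorem continuous_slowness (hv : IsCompleteSpeed v) : Continuous (slowness v) :=
  (hv.continuousOn.comp_continuous (by fun_prop) fun ξ => le_max_right ξ 0).inv₀
    fun ξ => (hv.pos _ (le_max_right ξ 0)).ne'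

theorem slowness_pos (hv : IsCompleteSpeed v) (ξ : ℝ) : 0 < slowness v ξ :=
  inv_pos.2 (hv.pos _ (le_max_right ξ 0))

theorem hasDerivAt_travelTime (hv : IsCompleteSpeed v) (ξ : ℝ) :
    HasDerivAt (travelTime v) (slowness v ξ) ξ :=
  (hv.continuous_slowness.integral_hasStrictDerivAt 0 ξ).hasDerivAt

theorem strictMono_travelTime (hv : IsCompleteSpeed v) : StrictMono (travelTime v) :=
  strictMono_of_hasDerivAt_pos hv.hasDerivAt_travelTime hv.slowness_pos

theorem tendsto_travelTime_atTop (hv : IsCompleteSpeed v) :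
    Tendsto (travelTime v) atTop atTop := by
  refine tendsto_atTop_atTop_of_monotone hv.strictMono_travelTime.monotone ?_
  by_contra! h_bdd
  obtain ⟨T, travelTime_lt⟩ := h_bdd
  have slowness_integrable : IntegrableOn (slowness v) (Ioi 0) := by
    refine integrableOn_Ioi_of_intervalIntegral_norm_bounded T 0
      (fun ξ => (hv.continuous_slowness.integrableOn_Icc (a := 0) (b := ξ)).mono_set
        Ioc_subset_Icc_self) tendsto_id (Eventually.of_forall fun ξ => ?_)
    simp_rw [Real.norm_of_nonneg (hv.slowness_pos _).le]
    exact (travelTime_lt ξ).le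
  refine hv.not_integrableOn_inv (slowness_integrable.congr_fun (fun ξ hξ => ?_) measurableSet_Ioi)
  exact slowness_of_nonneg v (mem_Ioi.1 hξ).le

theorem tendsto_travelTime_atBot (hv : IsCompleteSpeed v) :
    Tendsto (travelTime v) atBot atBot := by
  refine (tendsto_id.atBot_mul_const (inv_pos.2 (hv.pos 0 le_rfl))).congr' ?_
  filter_upwards [eventually_le_atBot (0 : ℝ)] with ξ hξ
  exact (travelTime_of_nonpos v hξ).symm

/-- The travel time as an order isomorphism. -/
def travelTimeIso (hv : IsCompleteSpeed v) : ℝ ≃o ℝ :=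
  hv.strictMono_travelTime.orderIsoOfSurjective _ <|
    (continuous_iff_continuousAt.2 fun ξ => (hv.hasDerivAt_travelTime ξ).continuousAt).surjective
      hv.tendsto_travelTime_atTop hv.tendsto_travelTime_atBot

theorem travelTimeIso_zero (hv : IsCompleteSpeed v) : hv.travelTimeIso 0 = 0 :=
  intervalIntegral.integral_same

theorem hasDerivAt_travelTimeIso (hv : IsCompleteSpeed v) (ξ : ℝ) :
    HasDerivAt hv.travelTimeIso (slowness v ξ) ξ :=
  hv.hasDerivAt_travelTime ξ

theorem travelTimeIso_nonneg (hv : IsCompleteSpeed v) {ξ : ℝ} (hξ : 0 ≤ ξ) :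
    0 ≤ hv.travelTimeIso ξ := by
  rw [← hv.travelTimeIso_zero]
  exact hv.travelTimeIso.monotone hξ

theorem integral_comp_travelTimeIso {E : Type*} [NormedAddCommGroup E] [NormedSpace ℝ E]
    (hv : IsCompleteSpeed v) (h : ℝ → E) {ξ : ℝ} (hξ : 0 ≤ ξ) :
    ∫ s in (0 : ℝ)..ξ, (v s)⁻¹ • h (hv.travelTimeIso s)
      = ∫ τ in (0 : ℝ)..hv.travelTimeIso ξ, h τ := by
  have image_Ioc : hv.travelTimeIso '' Ioc 0 ξ = Ioc 0 (hv.travelTimeIso ξ) := by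
    rw [hv.travelTimeIso.image_Ioc, hv.travelTimeIso_zero]
  rw [intervalIntegral.integral_of_le hξ,
    intervalIntegral.integral_of_le (hv.travelTimeIso_nonneg hξ), ← image_Ioc,
    integral_image_eq_integral_abs_deriv_smul measurableSet_Ioc
      (fun s _ => (hv.hasDerivAt_travelTimeIso s).hasDerivWithinAt)
      hv.travelTimeIso.injective.injOn]
  refine setIntegral_congr_fun measurableSet_Ioc fun s hs => ?_
  rw [abs_of_pos (hv.slowness_pos s), slowness_of_nonneg v hs.1.le]

/-- The travel time as a change of variables. -/
def travelTimeEquiv (hv : IsCompleteSpeed v) : ℝ ≃ᵐ ℝ :=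
  hv.travelTimeIso.toHomeomorph.toMeasurableEquiv

theorem measurePreserving_travelTimeEquiv (hv : IsCompleteSpeed v) :
    MeasurePreserving hv.travelTimeEquiv (vol0.withDensity fun ξ => ENNReal.ofReal (v ξ)⁻¹)
      vol0 := by
  refine ⟨hv.travelTimeEquiv.measurable, ?_⟩
  have density_ae : (fun ξ => ENNReal.ofReal (v ξ)⁻¹) =ᵐ[vol0] fun ξ => ENNReal.ofReal
      |((ContinuousLinearMap.toSpanSingleton ℝ (slowness v ξ)) : ℝ →L[ℝ] ℝ).det| := by
    filter_upwards [DiagCoeff.ae_pos] with ξ hξ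
    rw [ContinuousLinearMap.det_toSpanSingleton, abs_of_pos (hv.slowness_pos ξ),
      slowness_of_nonneg v hξ.le]
  have image_Ioi : hv.travelTimeIso '' Ioi 0 = Ioi 0 := by
    rw [hv.travelTimeIso.image_Ioi, hv.travelTimeIso_zero]
  rw [withDensity_congr_ae density_ae]
  conv_rhs => rw [vol0, ← image_Ioi]
  exact map_withDensity_abs_det_fderiv_eq_addHaar volume measurableSet_Ioi.nullMeasurableSet
    (fun ξ _ => (hv.hasDerivAt_travelTimeIso ξ).hasFDerivAt.hasFDerivWithinAt)
    hv.travelTimeIso.injective.injOn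

end IsCompleteSpeed

end TravelTime

theorem absolutelyContinuousOnInterval_of_dist_le {X Y : Type*} [PseudoMetricSpace X]
    [PseudoMetricSpace Y] {f : ℝ → X} {g : ℝ → Y} {a b : ℝ}
    (hg : AbsolutelyContinuousOnInterval g a b)
    (h : ∀ s ∈ uIcc a b, ∀ t ∈ uIcc a b, dist (f s) (f t) ≤ dist (g s) (g t)) :
    AbsolutelyContinuousOnInterval f a b := by
  rw [absolutelyContinuousOnInterval_iff] at hg ⊢
  intro ε hε
  obtain ⟨δ, hδ, sum_lt⟩ := hg ε hε
  refine ⟨δ, hδ, fun I hI hIδ => (Finset.sum_le_sum fun i hi => ?_).trans_lt (sum_lt I hI hIδ)⟩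
  obtain ⟨left_mem, right_mem⟩ := hI.1 i hi
  exact h _ left_mem _ right_mem

theorem absolutelyContinuousOnInterval_integral {E : Type*} [NormedAddCommGroup E]
    [NormedSpace ℝ E] {f : ℝ → E} {a b c : ℝ} (hf : IntervalIntegrable f volume a b)
    (hc : c ∈ uIcc a b) : AbsolutelyContinuousOnInterval (fun x => ∫ s in c..x, f s) a b := by
  refine absolutelyContinuousOnInterval_of_dist_le
    (hf.norm.absolutelyContinuousOnInterval_intervalIntegral hc) fun s hs t ht => ?_
  have integrable_to (x : ℝ) (hx : x ∈ uIcc a b) : IntervalIntegrable f volume c x :=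
    hf.mono_set (uIcc_subset_uIcc hc hx)
  rw [dist_eq_norm, dist_eq_norm,
    intervalIntegral.integral_interval_sub_left (integrable_to s hs) (integrable_to t ht),
    intervalIntegral.integral_interval_sub_left (integrable_to s hs).norm (integrable_to t ht).norm,
    Real.norm_eq_abs]
  exact intervalIntegral.norm_integral_le_abs_integral_norm

namespace DiagCoeff

variable {p q : ℕ} {D : DiagCoeff p q}

/-- The sign of the `i`-th diagonal entry of `Δ`. -/
def sgn : Idx p q → ℝ := Sum.elim (fun _ => 1) (fun _ => -1)

theorem sgn_ne_zero (i : Idx p q) : sgn i ≠ 0 := by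
  rcases i <;> norm_num [sgn]

theorem act_Delta {ξ : ℝ} (hξ : 0 ≤ ξ) (v : Idx p q → ℂ) (i : Idx p q) :
    act (D.Delta ξ) v i = sgn i • (D.wt i ξ * v i) := by
  rw [act, Delta, Lam, Theta, Matrix.fromBlocks_diagonal, Matrix.diagonal_map Complex.ofReal_zero,
    Matrix.mulVec_diagonal]
  rcases i with k | j
  · simp [sgn, wt]
  · simp [sgn, wt, abs_of_neg (D.theta_neg j ξ hξ)]

section OperatorGraph

theorem intervalIntegrable_fn (z : D.L2) {b : ℝ} (hb : 0 ≤ b) :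
    IntervalIntegrable (D.fn z) volume 0 b := by
  rw [intervalIntegrable_iff_integrableOn_Ioc_of_le hb]
  refine Integrable.of_eval fun i => ?_
  have weighted_integrable : IntegrableOn (fun ξ => D.rt i ξ * D.fn z ξ i) (Icc 0 b) :=
    integrableOn_Icc_iff_integrableOn_Ioc (by finiteness) |>.2 <| ((D.memLp_fn z i).mono_measure
      (Measure.restrict_mono_set volume Ioc_subset_Ioi_self)).integrable one_le_two
  have inv_rt_cont : ContinuousOn (fun ξ => (D.rt i ξ)⁻¹) (Icc 0 b) :=
    ((Complex.continuous_ofReal.comp_continuousOn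
      (Real.continuous_sqrt.comp_continuousOn (D.wt_cont i))).mono Icc_subset_Ici_self).inv₀
        fun ξ hξ => D.rt_ne i hξ.1
  refine ((weighted_integrable.continuousOn_mul inv_rt_cont isCompact_Icc).mono_set
    Ioc_subset_Icc_self).congr_fun (fun ξ hξ => ?_) measurableSet_Ioc
  exact inv_mul_cancel_left₀ (D.rt_ne i hξ.1.le) _

theorem intervalIntegral_fn_apply (z : D.L2) {b : ℝ} (hb : 0 ≤ b) (i : Idx p q) :
    (∫ s in (0 : ℝ)..b, D.fn z s) i = ∫ s in (0 : ℝ)..b, D.fn z s i :=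
  ((ContinuousLinearMap.proj (R := ℂ) (φ := fun _ : Idx p q => ℂ) i).intervalIntegral_comp_comm
    (intervalIntegrable_fn z hb)).symm

theorem acLoc_integral_fn (z : D.L2) : ACLoc fun ξ => ∫ s in (0 : ℝ)..ξ, D.fn z s := by
  intro a b ha hab
  refine (absolutelyContinuousOnInterval_integral (intervalIntegrable_fn z (ha.trans hab))
    left_mem_uIcc).mono ?_
  rw [uIcc_of_le hab, uIcc_of_le (ha.trans hab)]
  exact Icc_subset_Icc_left ha

theorem ae_hasDerivAt_integral_fn (z : D.L2) :
    ∀ᵐ ξ ∂vol0, HasDerivAt (fun ξ => ∫ s in (0 : ℝ)..ξ, D.fn z s) (D.fn z ξ) ξ := by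
  have deriv_ae (n : ℕ) : ∀ᵐ ξ, ξ ∈ uIcc (0 : ℝ) n → ∀ c ∈ uIcc (0 : ℝ) n,
      HasDerivAt (fun ξ => ∫ s in c..ξ, D.fn z s) (D.fn z ξ) ξ :=
    (intervalIntegrable_fn z n.cast_nonneg).ae_hasDerivAt_integral
  filter_upwards [ae_restrict_of_ae (ae_all_iff.2 deriv_ae), ae_pos] with ξ h hξ
  obtain ⟨n, hn⟩ := exists_nat_ge ξ
  refine h n ?_ 0 left_mem_uIcc
  rw [uIcc_of_le (hξ.le.trans hn)]
  exact ⟨hξ.le, hn⟩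

theorem IsDerivVia.eq_integral {x z : D.L2} {y : ℝ → Idx p q → ℂ} (h : D.IsDerivVia x z y)
    {ξ : ℝ} (hξ : 0 ≤ ξ) : y ξ = y 0 + ∫ s in (0 : ℝ)..ξ, D.fn z s := by
  obtain ⟨y_ac, -, y_deriv, -⟩ := h
  have diff_ac : AbsolutelyContinuousOnInterval (y - fun ξ => ∫ s in (0 : ℝ)..ξ, D.fn z s) 0 ξ :=
    (y_ac 0 ξ le_rfl hξ).sub (acLoc_integral_fn z 0 ξ le_rfl hξ)
  have diff_deriv : ∀ᵐ s, s ∈ uIcc 0 ξ →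
      HasDerivAt (y - fun ξ => ∫ s in (0 : ℝ)..ξ, D.fn z s) 0 s := by
    filter_upwards [(ae_restrict_iff' measurableSet_Ioi).1 (y_deriv.and
      (ae_hasDerivAt_integral_fn z)), Measure.ae_ne volume 0] with s deriv_s hs0 hs
    rw [uIcc_of_le hξ] at hs
    obtain ⟨deriv_y, deriv_integral⟩ := deriv_s (mem_Ioi.2 (hs.1.lt_of_ne' hs0))
    simpa only [sub_self] using deriv_y.sub deriv_integral
  obtain ⟨c, diff_eq⟩ := diff_ac.const_of_ae_hasDerivAt_zero diff_deriv
  have diff_zero := diff_eq 0 left_mem_uIcc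
  have diff_ξ := diff_eq ξ right_mem_uIcc
  simp only [Pi.sub_apply, intervalIntegral.integral_same, sub_zero] at diff_zero diff_ξ
  rw [diff_zero, ← diff_ξ, sub_add_cancel]

theorem exists_isDerivVia_iff {x z : D.L2} :
    (∃ y, D.IsDerivVia x z y) ↔ ∀ i, ∃ c : ℂ, (sgn i < 0 → c = 0) ∧
      ∀ᵐ ξ ∂vol0, act (D.Delta ξ) (D.fn x ξ) i = c + ∫ s in (0 : ℝ)..ξ, D.fn z s i := by
  constructor
  · rintro ⟨y, h⟩ i
    refine ⟨y 0 i, fun hi => ?_, ?_⟩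
    · rcases i with k | j
      · norm_num [sgn] at hi
      · exact h.2.2.2 j
    · filter_upwards [h.2.1, ae_pos] with ξ hy hξ
      rw [← hy, h.eq_integral hξ.le, Pi.add_apply, intervalIntegral_fn_apply z hξ.le]
  · intro h
    choose c hc h_ae using h
    refine ⟨fun ξ => c + ∫ s in (0 : ℝ)..ξ, D.fn z s, fun a b ha hab => ?_, ?_, ?_, fun j => ?_⟩
    · exact absolutelyContinuousOnInterval_of_dist_le (acLoc_integral_fn z a b ha hab)
        fun s _ t _ => (dist_add_left _ _ _).le
    · filter_upwards [ae_all_iff.2 h_ae, ae_pos] with ξ hy hξ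
      funext i
      rw [hy i, Pi.add_apply, intervalIntegral_fn_apply z hξ.le]
    · filter_upwards [ae_hasDerivAt_integral_fn z] with ξ h_deriv
      exact h_deriv.const_add c
    · simp only [intervalIntegral.integral_same, add_zero]
      exact hc (Sum.inr j) (by norm_num [sgn])

end OperatorGraph

section Characteristics

theorem isCompWeight_inv_rt {i : Idx p q} (hv : IsCompleteSpeed (D.wt i)) :
    IsCompWeight 2 (fun ξ => (D.rt i ξ)⁻¹) hv.travelTimeEquiv vol0 vol0 where
  aestronglyMeasurable := (D.rt_aesm i).inv₀
  ae_ne_zero := by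
    filter_upwards [ae_pos] with ξ hξ
    exact inv_ne_zero (D.rt_ne i hξ.le)
  measurePreserving := by
    have density_ae : (fun ξ => ‖(D.rt i ξ)⁻¹‖ₑ ^ (2 : ℝ≥0∞).toReal)
        =ᵐ[vol0] fun ξ => ENNReal.ofReal (D.wt i ξ)⁻¹ := by
      filter_upwards [ae_pos] with ξ hξ
      rw [ENNReal.toReal_ofNat, ENNReal.rpow_ofNat, ← ofReal_norm, ← ENNReal.ofReal_pow
        (norm_nonneg _), norm_inv, inv_pow, rt, Complex.norm_real, Real.norm_eq_abs, sq_abs,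
        Real.sq_sqrt (D.wt_pos i hξ.le).le]
    rw [withDensity_congr_ae density_ae]
    exact hv.measurePreserving_travelTimeEquiv

/-- The coordinates `τ ↦ (|Δ| x)ᵢ(ξ)` along the characteristics, where `τ` is the time it takes to
travel from `0` to `ξ` with speed `|Δ|ᵢᵢ`. In these coordinates `Δ` is constant. -/
def charEquiv (hD : ∀ i, IsCompleteSpeed (D.wt i)) : D.L2 ≃L[ℂ] (Idx p q → Lp ℂ 2 vol0) :=
  ((LinearIsometryEquiv.ofSurjective ⟨D.sqrtMap, D.norm_sqrtMap⟩
    D.sqrtMap_surjective).toContinuousLinearEquiv.trans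
      (PiLp.continuousLinearEquiv 2 ℂ fun _ => Lp ℂ 2 vol0)).trans <|
    ContinuousLinearEquiv.piCongrRight fun i =>
      ((isCompWeight_inv_rt (hD i)).weightedCompEquiv ℂ
        ENNReal.ofNat_ne_top).symm.toContinuousLinearEquiv

theorem charEquiv_comp_travelTimeIso (hD : ∀ i, IsCompleteSpeed (D.wt i)) (x : D.L2)
    (i : Idx p q) : ∀ᵐ ξ ∂vol0,
      charEquiv hD x i ((hD i).travelTimeIso ξ) = D.wt i ξ * D.fn x ξ i := by
  set hm := isCompWeight_inv_rt (hD i)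
  have weighted_eq : hm.weightedComp ℂ ENNReal.ofNat_ne_top (charEquiv hD x i)
      = (D.memLp_fn x i).toLp _ :=
    (hm.weightedCompEquiv ℂ ENNReal.ofNat_ne_top).apply_symm_apply _
  have weighted_ae := hm.coeFn_weightedComp ENNReal.ofNat_ne_top (charEquiv hD x i)
  rw [weighted_eq] at weighted_ae
  filter_upwards [weighted_ae, (D.memLp_fn x i).coeFn_toLp, ae_pos] with ξ h_weighted h_toLp hξ
  have rt_mul_rt : D.rt i ξ * D.rt i ξ = D.wt i ξ := by
    rw [rt, ← Complex.ofReal_mul, Real.mul_self_sqrt (D.wt_pos i hξ.le).le]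
  rw [h_toLp, smul_eq_mul, eq_inv_mul_iff_mul_eq₀ (D.rt_ne i hξ.le), ← mul_assoc,
    rt_mul_rt] at h_weighted
  exact h_weighted.symm

theorem primitive_charEquiv (hD : ∀ i, IsCompleteSpeed (D.wt i)) (z : D.L2) (i : Idx p q)
    {ξ : ℝ} (hξ : 0 ≤ ξ) :
    primitive (charEquiv hD z i) ((hD i).travelTimeIso ξ) = ∫ s in (0 : ℝ)..ξ, D.fn z s i := by
  rw [primitive_congr_ae ((hD i).travelTimeIso_nonneg hξ) ae_eq_rfl,
    ← (hD i).integral_comp_travelTimeIso _ hξ]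
  refine intervalIntegral.integral_congr_ae ?_
  filter_upwards [(ae_restrict_iff' measurableSet_Ioi).1 (charEquiv_comp_travelTimeIso hD z i)]
    with s char_eq hs
  rw [uIoc_of_le hξ] at hs
  rw [char_eq hs.1, Complex.real_smul, Complex.ofReal_inv, inv_mul_cancel_left₀
    (Complex.ofReal_ne_zero.2 (D.wt_pos i hs.1.le).ne')]

theorem hasTransportDeriv_charEquiv_iff (hD : ∀ i, IsCompleteSpeed (D.wt i)) {x z : D.L2}
    {i : Idx p q} :
    HasTransportDeriv (sgn i) (charEquiv hD x i) (charEquiv hD z i) ↔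
      ∃ c : ℂ, (sgn i < 0 → c = 0) ∧
        ∀ᵐ ξ ∂vol0, act (D.Delta ξ) (D.fn x ξ) i = c + ∫ s in (0 : ℝ)..ξ, D.fn z s i := by
  refine exists_congr fun c => and_congr_right fun _ => ?_
  rw [← (isCompWeight_inv_rt (hD i)).ae_comp_iff]
  refine eventually_congr ?_
  filter_upwards [charEquiv_comp_travelTimeIso hD x i, ae_pos] with ξ char_eq hξ
  change sgn i • charEquiv hD x i ((hD i).travelTimeIso ξ)
    = c + primitive (charEquiv hD z i) ((hD i).travelTimeIso ξ) ↔ _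
  rw [char_eq, primitive_charEquiv hD z i hξ.le, act_Delta hξ.le]

theorem generatesC0Semigroup_opA (hD : ∀ i, IsCompleteSpeed (D.wt i)) :
    GeneratesC0Semigroup D.opA := by
  refine ⟨(C0Semigroup.pi fun i => shiftSemigroup ℂ (ENNReal.ofNat_ne_top (n := 2)) (sgn i)).conj
    (charEquiv hD), fun x z => ?_⟩
  rw [opA_iff, exists_isDerivVia_iff]
  refine Iff.trans (forall_congr' fun i => ?_)
    (C0Semigroup.hasOrbitDeriv_conj.trans C0Semigroup.hasOrbitDeriv_pi).symm
  rw [hasOrbitDeriv_shiftSemigroup_iff (sgn_ne_zero i), hasTransportDeriv_charEquiv_iff]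

end Characteristics

end DiagCoeff

end DiagTransport

end

theorem proposition4p5 (np nm : ℕ) (hnp : 1 ≤ np) (hnm : 1 ≤ nm)
    (lam : Fin np → ℝ → ℝ) (theta : Fin nm → ℝ → ℝ)
    (lam_cont : ∀ k, ContinuousOn (lam k) (Set.Ici 0))
    (theta_cont : ∀ j, ContinuousOn (theta j) (Set.Ici 0))
    (lam_pos : ∀ k, ∀ ξ ∈ Set.Ici (0 : ℝ), 0 < lam k ξ)
    (theta_neg : ∀ j, ∀ ξ ∈ Set.Ici (0 : ℝ), theta j ξ < 0)
    (lam_inv : ∀ k, ¬ MeasureTheory.IntegrableOn (fun ξ => 1 / lam k ξ) (Set.Ioi 0)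
      MeasureTheory.volume)
    (theta_inv : ∀ j, ¬ MeasureTheory.IntegrableOn (fun ξ => 1 / theta j ξ) (Set.Ioi 0)
      MeasureTheory.volume) :
    DiagTransport.GeneratesC0Semigroup
      (DiagTransport.DiagCoeff.opA
        (⟨lam, theta, lam_cont, theta_cont, lam_pos, theta_neg⟩ :
          DiagTransport.DiagCoeff np nm)) := by
  refine DiagTransport.DiagCoeff.generatesC0Semigroup_opA fun i =>
    ⟨DiagTransport.DiagCoeff.wt_cont _ i, fun _ => DiagTransport.DiagCoeff.wt_pos _ i, ?_⟩
  rcases i with k | j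
  · simpa only [DiagTransport.DiagCoeff.wt, Sum.elim_inl, one_div] using lam_inv k
  · refine fun h => theta_inv j (h.neg.congr_fun (fun ξ hξ => ?_) measurableSet_Ioi)
    change -|theta j ξ|⁻¹ = 1 / theta j ξ
    rw [abs_of_neg (theta_neg j ξ (Set.Ioi_subset_Ici_self hξ)), inv_neg, neg_neg, one_div]
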